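/- Let $(A,\mathfrak m)$ be a Noetherian local ring and $M$ a finitely generated $A$-module with $\dim_A M\ge 2$ and $\operatorname{depth}_A M>0$, such that the local cohomology module $H^1_{\mathfrak m}(M)$ is finitely generated. Put $\mathfrak c=(0):_A H^1_{\mathfrak m}(M)$ and let $W$ be the set of nonzerodivisors on $M$. A sequence $a_1,a_2\in\mathfrak m$ is called filter regular on $M$ if $a_1\notin\mathfrak p$ for all $\mathfrak p\in\operatorname{Ass}_A M\setminus\{\mathfrak m\}$ and $a_2\notin\mathfrak p$ for all $\mathfrak p\in\operatorname{Ass}_A(M/a_1M)\setminus\{\mathfrak m\}$. There exist elements $a_1,a_2\in\mathfrak c$ that form a filter regular sequence on $M$. For any such $a_1,a_2$ one has $a_1\in W$; put $$\widetilde M=\{m/a_1\in W^{-1}M\mid m\in a_1M:_M a_2\},\qquad i:M\to\widetilde M,\quad m\mapsto m/1 .$$ Then $i$ is injective, $(a_1,a_2)\cdot\operatorname{Coker} i=(0)$, and the following hold. (A) Let $X$ be an $A$-module and $f:M\to X$ a monomorphism of $A$-modules with $(a_1,a_2)\cdot\operatorname{Coker} f=(0)$. Then there is a unique $A$-homomorphism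 $g:X\to\widetilde M$ with $g\circ f=i$. Moreover: 1. The following are equivalent: (1) $g$ is injective; (2) $a_1$ is a regular element on $X$; (3) $\operatorname{depth}_A X>0$ and $\ell_A(\operatorname{Coker} f)<\infty$. 2. The following are equivalent: (1) $g$ is bijective; (2) $a_1,a_2$ is a regular sequence on $X$; (3) $\operatorname{depth}_A X\ge 2$ and $\ell_A(\operatorname{Coker} f)<\infty$. (B) Let $X$ be an $A$-module and $f:M\to X$ a monomorphism of $A$-modules with $\operatorname{depth}_A X\ge2$ and $\ell_A(\operatorname{Coker} f)<\infty$. Then there is a unique $A$-homomorphism $g:X\to\widetilde M$ with $g\circ f=i$, and it is an isomorphism. In other words, every overmodule $X$ of $M$ with $\operatorname{depth}_A X\ge 2$ and $\ell_A(X/M)<\infty$ equals $\widetilde M$. -/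

import Mathlib

open scoped nonZeroSMulDivisors

universe u v

section

variable (A : Type u) [CommRing A] (M : Type v) [AddCommGroup M] [Module A M]

/-- The depth of a (nonzero, finitely generated) module over a local ring: the supremum of the
lengths of the regular sequences on it that consist of elements of the maximal ideal. -/
noncomputable def moduleDepth [IsLocalRing A] : ℕ∞ :=
  ⨆ rs ∈ {rs : List A | (∀ r ∈ rs, r ∈ IsLocalRing.maximalIdeal A) ∧
    RingTheory.Sequence.IsRegular M rs}, (rs.length : ℕ∞)

variable {A}

/-- A sequence of elements of the maximal ideal is filter regular on `M` if its `i`-th element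
avoids every associated prime of `M / (a₁, …, aᵢ₋₁) M` other than the maximal ideal. -/
def IsFilterRegular [IsLocalRing A] (rs : List A) : Prop :=
  (∀ r ∈ rs, r ∈ IsLocalRing.maximalIdeal A) ∧
    ∀ (i : ℕ) (hi : i < rs.length),
      ∀ p ∈ associatedPrimes A (M ⧸ (Ideal.ofList (rs.take i) • ⊤ : Submodule A M)),
        p ≠ IsLocalRing.maximalIdeal A → rs[i] ∉ p

/-- For a nonzerodivisor `a` on `M` and `b : A`, the submodule `{m / a | m ∈ aM :_M b}` of the
localization of `M` at the set `A⁰[M]` of all nonzerodivisors on `M`. -/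
def tildeModule (a : A⁰[M]) (b : A) : Submodule A (LocalizedModule (A⁰[M]) M) where
  carrier := {x | ∃ m : M, (∃ n : M, b • m = (a : A) • n) ∧ x = LocalizedModule.mk m a}
  add_mem' := by
    rintro _ _ ⟨m, ⟨n, hn⟩, rfl⟩ ⟨m', ⟨n', hn'⟩, rfl⟩
    exact ⟨m + m', ⟨n + n', by rw [smul_add, smul_add, hn, hn']⟩, by
      rw [LocalizedModule.mk_add_mk, ← smul_add, LocalizedModule.mk_cancel_common_left]⟩
  zero_mem' := ⟨0, ⟨0, by simp⟩, (LocalizedModule.zero_mk a).symm⟩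
  smul_mem' := by
    rintro c _ ⟨m, ⟨n, hn⟩, rfl⟩
    exact ⟨c • m, ⟨c • n, by rw [smul_comm b, hn, smul_comm c]⟩, by
      rw [LocalizedModule.smul'_mk]⟩

theorem mkLinearMap_mem_tildeModule (a : A⁰[M]) (b : A) (m : M) :
    LocalizedModule.mkLinearMap (A⁰[M]) M m ∈ tildeModule M a b :=
  ⟨(a : A) • m, ⟨b • m, smul_comm _ _ _⟩, (LocalizedModule.mk_cancel a m).symm⟩

/-- The natural map `m ↦ m / 1` from `M` to `tildeModule M a b`. -/
noncomputable def toTildeModule (a : A⁰[M]) (b : A) : M →ₗ[A] tildeModule M a b :=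
  (LocalizedModule.mkLinearMap (A⁰[M]) M).codRestrict (tildeModule M a b)
    (mkLinearMap_mem_tildeModule M a b)

end

/-- The ideal `(0) :_A H` where `H` is the first local cohomology module of `M` with respect to
the maximal ideal. -/
noncomputable def annLocalCohomologyOne (A : Type u) [CommRing A] [IsLocalRing A]
    (M : Type u) [AddCommGroup M] [Module A M] : Ideal A :=
  Module.annihilator A
    ((localCohomology (IsLocalRing.maximalIdeal A) 1).obj (ModuleCat.of A M))

/-! Write a, b for the two elements. Inside W⁻¹M, M~ is the set of z with az, bz ∈ M
(`mem_tildeModule_iff`). So an overmodule X with cokernel killed by (a, b) maps to M~ over M in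
exactly one way, x ↦ (ax)/a; as a acts injectively on M~, this map is injective iff a is regular on
X. Filter regularity makes a power of 𝔪 kill (aM : b)/aM, hence M~/M.

The pivot is `smul_mem_range_of_mem_annLocalCohomologyOne`: if some r ∈ 𝔪 is regular on X and 𝔪^k x
⊆ M, then cx ∈ M for every c ∈ 𝔠. Indeed j ↦ jx is a map 𝔪^k → M; its class in Ext¹(A/𝔪^k, M) dies
in H¹ after multiplication by c, so c(jx) = jw for some w ∈ M and all j in a smaller power 𝔪^t.
Taking j = r^t and cancelling gives cx = w.

This makes a, b regular on M~: if bx = ay, then z = x/a is moved into M by a power of 𝔪, so az, bz ∈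
M and z ∈ M~. It also reduces (B) to (A). Conversely, a submodule X of M~ containing M and of depth
at least two absorbs every z with 𝔪^k z ⊆ X, hence is all of M~. -/

/-! ### Cocycle representatives of Ext¹ -/

section ExtCocycle

open CategoryTheory Limits Opposite

variable {A : Type u} [CommRing A] {N N' : ModuleCat.{u} A} (Y : ModuleCat.{u} A)

/-- The complex in the opposite category obtained by applying `Hom(-, Y)` to a projective
resolution. -/
noncomputable abbrev CategoryTheory.ProjectiveResolution.homComplex
    (P : ProjectiveResolution N) : ChainComplex (ModuleCat.{u} A)ᵒᵖ ℕ :=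
  (((linearYoneda A (ModuleCat.{u} A)).obj Y).rightOp.mapHomologicalComplex _).obj P.complex

/-- The first `Ext` module, in the opposite category, is the homology of `Hom(P, Y)`. -/
noncomputable def CategoryTheory.ProjectiveResolution.leftDerivedIso (P : ProjectiveResolution N) :
    (((linearYoneda A (ModuleCat.{u} A)).obj Y).rightOp.leftDerived 1).obj N ≅
      (P.homComplex Y).homology 1 :=
  P.isoLeftDerivedObj ((linearYoneda A (ModuleCat.{u} A)).obj Y).rightOp 1

/-- The projection from the `1`-cocycles of `Hom(P, Y)` onto the first `Ext` module. -/
noncomputable def CategoryTheory.ProjectiveResolution.cocycleToExt (P : ProjectiveResolution N) :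
    ((P.homComplex Y).opcycles 1).unop ⟶
      ((Ext A (ModuleCat.{u} A) 1).obj (op N)).obj Y :=
  ((P.leftDerivedIso Y).hom ≫ (P.homComplex Y).homologyι 1).unop

/-- The inclusion of the `1`-cocycles of `Hom(P, Y)`. -/
noncomputable def CategoryTheory.ProjectiveResolution.cocycleToHom (P : ProjectiveResolution N) :
    ((P.homComplex Y).opcycles 1).unop ⟶ ModuleCat.of A (P.complex.X 1 ⟶ Y) :=
  ((P.homComplex Y).pOpcycles 1).unop

variable {Y}

/-- The cocycle `φ` of a projective resolution of `N` represents the class `e`. -/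
def CategoryTheory.ProjectiveResolution.Represents (P : ProjectiveResolution N)
    (φ : P.complex.X 1 ⟶ Y) (e : ((Ext A (ModuleCat.{u} A) 1).obj (op N)).obj Y) : Prop :=
  ∃ o, (P.cocycleToHom Y).hom o = φ ∧ (P.cocycleToExt Y).hom o = e

namespace CategoryTheory.ProjectiveResolution

variable (P : ProjectiveResolution N) (P' : ProjectiveResolution N')

theorem cocycleToExt_surjective : Function.Surjective (P.cocycleToExt Y).hom := by
  rw [← ModuleCat.epi_iff_surjective]
  exact unop_epi_of_mono ((P.leftDerivedIso Y).hom ≫ (P.homComplex Y).homologyι 1)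

theorem exists_represents (e : ((Ext A (ModuleCat.{u} A) 1).obj (op N)).obj Y) :
    ∃ φ, P.Represents φ e := by
  obtain ⟨o, rfl⟩ := P.cocycleToExt_surjective e
  exact ⟨_, o, rfl, rfl⟩

theorem exists_represents_of_comp_eq_zero (φ : P.complex.X 1 ⟶ Y)
    (hφ : P.complex.d 2 1 ≫ φ = 0) : ∃ e, P.Represents φ e := by
  have hex := (ShortComplex.exact_of_g_is_cokernel
    (ShortComplex.mk ((P.homComplex Y).d 2 1) ((P.homComplex Y).pOpcycles 1)
      ((P.homComplex Y).d_pOpcycles 2 1))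
    ((P.homComplex Y).opcyclesIsCokernel 2 1 (by simp))).unop
  rw [ShortComplex.moduleCat_exact_iff] at hex
  obtain ⟨o, ho⟩ := hex φ hφ
  exact ⟨_, o, ho, rfl⟩

variable {P} in
theorem Represents.smul {φ : P.complex.X 1 ⟶ Y}
    {e : ((Ext A (ModuleCat.{u} A) 1).obj (op N)).obj Y} (h : P.Represents φ e) (r : A) :
    P.Represents (r • φ) (r • e) := by
  obtain ⟨o, rfl, rfl⟩ := h
  exact ⟨r • o, map_smul _ _ _, map_smul _ _ _⟩

variable {P} in
-- Homology is the kernel of `fromOpcycles`; reversing arrows, Ext¹ becomes cocycles modulo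
-- coboundaries.
theorem Represents.eq_zero_iff {φ : P.complex.X 1 ⟶ Y}
    {e : ((Ext A (ModuleCat.{u} A) 1).obj (op N)).obj Y} (h : P.Represents φ e) :
    e = 0 ↔ ∃ ψ : P.complex.X 0 ⟶ Y, φ = P.complex.d 1 0 ≫ ψ := by
  obtain ⟨o, rfl, rfl⟩ := h
  have hex := (ShortComplex.exact_of_f_is_kernel
    (ShortComplex.mk _ ((P.homComplex Y).fromOpcycles 1 0)
      ((P.homComplex Y).homologyι_comp_fromOpcycles 1 0))
    ((P.homComplex Y).homologyIsKernel 1 0 (by simp))).unop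
  rw [ShortComplex.moduleCat_exact_iff] at hex
  have hd : ∀ ψ : P.complex.X 0 ⟶ Y,
      (P.cocycleToHom Y).hom (((P.homComplex Y).fromOpcycles 1 0).unop.hom ψ) =
        P.complex.d 1 0 ≫ ψ := fun ψ ↦
    congr($(congr(($((P.homComplex Y).p_fromOpcycles 1 0)).unop.hom)) ψ)
  have hinj : Function.Injective (P.cocycleToHom Y).hom := by
    rw [← ModuleCat.mono_iff_injective]
    exact unop_mono_of_epi ((P.homComplex Y).pOpcycles 1)
  have hiso : Function.Injective (P.leftDerivedIso Y).hom.unop.hom :=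
    (ModuleCat.mono_iff_injective _).1 (unop_mono_of_epi (P.leftDerivedIso Y).hom)
  constructor
  · intro h0
    obtain ⟨ψ, hψ⟩ := hex o (hiso (h0.trans (map_zero _).symm))
    exact ⟨ψ, (congr((P.cocycleToHom Y).hom $hψ)).symm.trans (hd ψ)⟩
  · rintro ⟨ψ, hψ⟩
    have h1 := hinj (hψ.trans (hd ψ).symm)
    have h2 : ((P.homComplex Y).homologyι 1).unop.hom
        (((P.homComplex Y).fromOpcycles 1 0).unop.hom ψ) = 0 :=
      congr($(congr(($((P.homComplex Y).homologyι_comp_fromOpcycles 1 0)).unop.hom)) ψ)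
    exact (congr((P.cocycleToExt Y).hom $h1)).trans
      ((congr((P.leftDerivedIso Y).hom.unop.hom $h2)).trans (map_zero _))

variable {P} in
theorem Represents.map {φ : P.complex.X 1 ⟶ Y}
    {e : ((Ext A (ModuleCat.{u} A) 1).obj (op N)).obj Y} (h : P.Represents φ e)
    (f : N' ⟶ N) (α : P'.complex ⟶ P.complex) (hα : α.f 0 ≫ P.π.f 0 = P'.π.f 0 ≫ f) :
    P'.Represents (α.f 1 ≫ φ) ((((Ext A (ModuleCat.{u} A) 1).map f.op).app Y).hom e) := by
  obtain ⟨o, rfl, rfl⟩ := h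
  let F := ((linearYoneda A (ModuleCat.{u} A)).obj Y).rightOp
  let β := (F.mapHomologicalComplex _).map α
  refine ⟨(HomologicalComplex.opcyclesMap β 1).unop.hom o, ?_, ?_⟩
  · exact congr($(congr(($(HomologicalComplex.p_opcyclesMap β 1)).unop.hom)) o)
  · have h1 : (F.leftDerived 1).map f ≫ (P.leftDerivedIso Y).hom =
        (P'.leftDerivedIso Y).hom ≫ HomologicalComplex.homologyMap β 1 :=
      P'.isoLeftDerivedObj_hom_naturality f P α hα F 1
    have h2 : HomologicalComplex.homologyMap β 1 ≫ (P.homComplex Y).homologyι 1 =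
        (P'.homComplex Y).homologyι 1 ≫ HomologicalComplex.opcyclesMap β 1 :=
      HomologicalComplex.homologyι_naturality β 1
    have h3 : (F.leftDerived 1).map f ≫ (P.leftDerivedIso Y).hom ≫
        (P.homComplex Y).homologyι 1 =
        ((P'.leftDerivedIso Y).hom ≫ (P'.homComplex Y).homologyι 1) ≫
          HomologicalComplex.opcyclesMap β 1 := by
      rw [reassoc_of% h1, Category.assoc, ← h2]
    exact congr($(congr(($(h3)).unop.hom)) o).symm

end CategoryTheory.ProjectiveResolution
end ExtCocycle

/-! ### Ext¹ of cyclic modules and homomorphisms on ideals -/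

section ExtQuotient

open CategoryTheory Limits Opposite

variable {A : Type u} [CommRing A] {N : ModuleCat.{u} A} {Y : ModuleCat.{u} A}

namespace CategoryTheory.ProjectiveResolution

variable (P : ProjectiveResolution N)

/-- The augmentation of a projective resolution as a linear map. -/
noncomputable def augmentation : P.complex.X 0 →ₗ[A] N :=
  (P.π.f 0).hom

theorem augmentation_surjective : Function.Surjective P.augmentation :=
  (ModuleCat.epi_iff_surjective (P.π.f 0)).1 inferInstance

theorem augmentation_d (y : P.complex.X 1) : P.augmentation ((P.complex.d 1 0).hom y) = 0 :=
  congr($(P.complex_d_comp_π_f_zero).hom y)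

theorem exists_d_eq_of_augmentation_eq_zero (x : P.complex.X 0) (hx : P.augmentation x = 0) :
    ∃ y, (P.complex.d 1 0).hom y = x :=
  (ShortComplex.moduleCat_exact_iff _).1 P.exact₀ x hx

theorem exists_d_eq_of_d_eq_zero (x : P.complex.X 1) (hx : (P.complex.d 1 0).hom x = 0) :
    ∃ y, (P.complex.d 2 1).hom y = x :=
  (ShortComplex.moduleCat_exact_iff _).1 (P.exact_succ 0) x hx

variable {P} in
theorem Represents.d_comp {φ : P.complex.X 1 ⟶ Y}
    {e : ((Ext A (ModuleCat.{u} A) 1).obj (op N)).obj Y} (h : P.Represents φ e) :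
    P.complex.d 2 1 ≫ φ = 0 := by
  obtain ⟨o, rfl, rfl⟩ := h
  exact congr($(congr(($((P.homComplex Y).d_pOpcycles 2 1)).unop.hom)) o)

end CategoryTheory.ProjectiveResolution

open ProjectiveResolution

/-- A scalar which kills `N` kills the first `Ext` module of `N`. -/
theorem ext_one_smul_eq_zero (r : A) (hr : ∀ x : N, r • x = 0)
    (e : ((Ext A (ModuleCat.{u} A) 1).obj (op N)).obj Y) : r • e = 0 := by
  let P := projectiveResolution N
  obtain ⟨φ, hφ⟩ := P.exists_represents e
  rw [(hφ.smul r).eq_zero_iff]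
  let d := (P.complex.d 1 0).hom
  have hker : LinearMap.ker d ≤ LinearMap.ker φ.hom := by
    intro x hx
    obtain ⟨y, rfl⟩ := P.exists_d_eq_of_d_eq_zero x hx
    exact congr($(hφ.d_comp).hom y)
  -- Since r kills N, multiplication by r on P₀ lands in the boundaries, where d can be inverted
  -- modulo its kernel; φ factors through that quotient.
  have hmem : ∀ x, (r • LinearMap.id : P.complex.X 0 →ₗ[A] P.complex.X 0) x ∈ LinearMap.range d :=
    fun x ↦ P.exists_d_eq_of_augmentation_eq_zero _ (by simp [hr])
  let ψ : P.complex.X 0 →ₗ[A] Y := (LinearMap.ker d).liftQ φ.hom hker ∘ₗ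
    d.quotKerEquivRange.symm.toLinearMap ∘ₗ LinearMap.codRestrict _ _ hmem
  refine ⟨ModuleCat.ofHom ψ, ?_⟩
  ext y
  have : LinearMap.codRestrict (LinearMap.range d) _ hmem (d y) =
      d.quotKerEquivRange (Submodule.Quotient.mk (r • y)) := by
    ext
    simp
  change r • φ.hom y = (LinearMap.ker d).liftQ φ.hom hker (d.quotKerEquivRange.symm
    (LinearMap.codRestrict (LinearMap.range d) _ hmem (d y)))
  rw [this, LinearEquiv.symm_apply_apply, Submodule.liftQ_apply, map_smul]

/-- A homomorphism `φ` on an ideal `J` has a class in the first `Ext` module of `A ⧸ J`, and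
scalar multiples of it restrict to homotheties where the class vanishes. -/
theorem exists_ext_one_class (J : Ideal A) (φ : J →ₗ[A] Y) :
    ∃ e : ((Ext A (ModuleCat.{u} A) 1).obj (op (ModuleCat.of A (A ⧸ J)))).obj Y,
      ∀ (c : A) (J' : Ideal A) (h : J' ≤ J),
        (((Ext A (ModuleCat.{u} A) 1).map
          (ModuleCat.ofHom (Submodule.mapQ J' J LinearMap.id h)).op).app Y).hom (c • e) = 0 →
        ∃ w : Y, ∀ j (hj : j ∈ J'), c • φ ⟨j, h hj⟩ = j • w := by
  let P := projectiveResolution (ModuleCat.of A (A ⧸ J))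
  let toQuot : ModuleCat.of A A ⟶ ModuleCat.of A (A ⧸ J) := ModuleCat.ofHom J.mkQ
  have : Epi toQuot := (ModuleCat.epi_iff_surjective _).2 (Submodule.mkQ_surjective J)
  let aug : P.complex.X 0 ⟶ ModuleCat.of A (A ⧸ J) := P.π.f 0
  -- This lift of the augmentation to `A` sends boundaries into `J`, so φ ∘ lam ∘ d makes sense and
  -- is a cocycle.
  let lam : P.complex.X 0 ⟶ ModuleCat.of A A := Projective.factorThru aug toQuot
  have hlam : ∀ x, J.mkQ (lam.hom x) = P.augmentation x := fun x ↦
    congr($(Projective.factorThru_comp aug toQuot).hom x)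
  have hmem : ∀ x, (lam.hom ∘ₗ (P.complex.d 1 0).hom) x ∈ J := fun x ↦ by
    rw [← Submodule.Quotient.mk_eq_zero J]
    exact (hlam _).trans (P.augmentation_d x)
  let Φ : P.complex.X 1 ⟶ Y := ModuleCat.ofHom (φ ∘ₗ LinearMap.codRestrict J _ hmem)
  obtain ⟨e, he⟩ := P.exists_represents_of_comp_eq_zero Φ (by
    ext x
    have : LinearMap.codRestrict J _ hmem ((P.complex.d 2 1).hom x) = 0 := by
      ext
      have h0 : (P.complex.d 1 0).hom ((P.complex.d 2 1).hom x) = 0 :=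
        congr($(P.complex.d_comp_d 2 1 0).hom x)
      simp [h0]
    exact congr(φ $this).trans (map_zero _))
  refine ⟨e, fun c J' h h0 ↦ ?_⟩
  let f : ModuleCat.of A (A ⧸ J') ⟶ ModuleCat.of A (A ⧸ J) :=
    ModuleCat.ofHom (Submodule.mapQ J' J LinearMap.id h)
  let P' := projectiveResolution (ModuleCat.of A (A ⧸ J'))
  let α := ProjectiveResolution.lift f P' P
  have hα : α.f 0 ≫ P.π.f 0 = P'.π.f 0 ≫ f := ProjectiveResolution.lift_commutes_zero f P' P
  obtain ⟨ψ, hψ⟩ := ((he.smul c).map P' f α hα).eq_zero_iff.1 h0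
  obtain ⟨p, hp⟩ := P'.augmentation_surjective (J'.mkQ 1)
  let μ : P'.complex.X 0 →ₗ[A] A := lam.hom ∘ₗ (α.f 0).hom
  have hμ : μ p - 1 ∈ J := by
    rw [← Submodule.Quotient.mk_eq_zero J, Submodule.Quotient.mk_sub, sub_eq_zero]
    have h1 : P.augmentation ((α.f 0).hom p) = f.hom (P'.augmentation p) := congr($(hα).hom p)
    exact (hlam _).trans (h1.trans (by rw [hp]; simp [f]))
  -- `p` lifts 1, but `μ p` equals 1 only modulo `J`; the second term cancels the contribution of
  -- the error `μ p - 1`.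
  refine ⟨ψ.hom p - c • φ ⟨_, hμ⟩, fun j hj ↦ ?_⟩
  obtain ⟨q, hq⟩ := P'.exists_d_eq_of_augmentation_eq_zero (j • p) (by
    rw [map_smul, hp, ← map_smul]
    simpa [Ideal.Quotient.eq_zero_iff_mem] using hj)
  have h1 : c • φ (LinearMap.codRestrict J _ hmem ((α.f 1).hom q)) =
      ψ.hom ((P'.complex.d 1 0).hom q) := congr($(hψ).hom q)
  have h2 : (P.complex.d 1 0).hom ((α.f 1).hom q) = (α.f 0).hom ((P'.complex.d 1 0).hom q) :=
    congr($(α.comm 1 0).hom q)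
  have h3 : LinearMap.codRestrict J _ hmem ((α.f 1).hom q) =
      ⟨j, h hj⟩ + j • (⟨_, hμ⟩ : J) := by
    ext
    have : lam.hom ((P.complex.d 1 0).hom ((α.f 1).hom q)) = j * μ p := by
      rw [h2, hq, map_smul, map_smul]; rfl
    simp only [LinearMap.codRestrict_apply, LinearMap.comp_apply, this]
    simp
    ring
  rw [h3, hq, map_smul, map_add, map_smul, smul_add] at h1
  rw [smul_sub, ← h1, smul_comm j c]
  abel

end ExtQuotient

/-! ### H¹ as a filtered colimit of Ext¹ -/

section LocalCohomologyOne

open CategoryTheory Limits Opposite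

variable {A : Type u} [CommRing A] (J : Ideal A) (M : ModuleCat.{u} A)

/-- The colimit cocone which computes local cohomology of a module. -/
noncomputable def localCohomology.cocone (i : ℕ) :
    Cocone (localCohomology.diagram (localCohomology.idealPowersDiagram J) i ⋙
      (evaluation _ _).obj M) :=
  have := localCohomology.hasColimitDiagram.{u, 0} (localCohomology.idealPowersDiagram J) i
  ((evaluation _ _).obj M).mapCocone
    (colimit.cocone (localCohomology.diagram (localCohomology.idealPowersDiagram J) i))

/-- `localCohomology.cocone` is a colimit. -/
noncomputable def localCohomology.isColimitCocone (i : ℕ) :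
    IsColimit (localCohomology.cocone J M i) :=
  have := localCohomology.hasColimitDiagram.{u, 0} (localCohomology.idealPowersDiagram J) i
  isColimitOfPreserves _ (colimit.isColimit _)

/-- The index category lives in universe 0, so preservation of filtered colimits has to be brought
down from universe `u`. -/
instance : PreservesColimitsOfShape ℕᵒᵖᵒᵖ (forget (ModuleCat.{u} A)) :=
  have := preservesFilteredColimitsOfSize_shrink.{0, u, 0, u} (forget (ModuleCat.{u} A))
  inferInstance

/-- Each element comes from some Ext¹(A/Jⁿ, M), which Jⁿ kills. -/
theorem exists_pow_smul_localCohomology_eq_zero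
    (e : (localCohomology J 1).obj M) : ∃ n, ∀ r ∈ J ^ n, r • e = 0 := by
  obtain ⟨t, x, hx⟩ := Concrete.isColimit_exists_rep _ (localCohomology.isColimitCocone J M 1) e
  refine ⟨t.unop.unop, fun r hr ↦ ?_⟩
  have hquot : ∀ y : A ⧸ J ^ t.unop.unop, r • y = 0 := fun y ↦ by
    obtain ⟨y, rfl⟩ := Submodule.Quotient.mk_surjective _ y
    rw [← Submodule.Quotient.mk_smul, Submodule.Quotient.mk_eq_zero]
    exact Ideal.mul_mem_right _ _ hr
  have h0 : r • x = 0 := ext_one_smul_eq_zero r hquot x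
  rw [← hx]
  exact (map_smul ((localCohomology.cocone J M 1).ι.app t).hom r x).symm.trans
    (congr(((localCohomology.cocone J M 1).ι.app t).hom $h0).trans (map_zero _))

/-- A class that is zero in the colimit is already zero at some stage A/J^t. -/
theorem exists_smul_eq_smul_of_smul_localCohomology_eq_zero (c : A)
    (hc : ∀ e : (localCohomology J 1).obj M, c • e = 0) (k : ℕ)
    (φ : ↥(J ^ k) →ₗ[A] M) :
    ∃ (t : ℕ) (h : k ≤ t) (w : M), ∀ j (hj : j ∈ J ^ t),
      c • φ ⟨j, Ideal.pow_le_pow_right h hj⟩ = j • w := by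
  obtain ⟨e, he⟩ := exists_ext_one_class (J ^ k) φ
  let D := localCohomology.diagram (localCohomology.idealPowersDiagram J) 1 ⋙
    (evaluation _ _).obj M
  let x : D.obj (op (op k)) := e
  have h1 : ((localCohomology.cocone J M 1).ι.app (op (op k))).hom (c • x) =
      ((localCohomology.cocone J M 1).ι.app (op (op k))).hom 0 := by
    rw [map_smul, map_zero]
    exact hc _
  obtain ⟨t, f, g, hfg⟩ := Concrete.isColimit_exists_of_rep_eq D
    (localCohomology.isColimitCocone J M 1) _ _ h1
  have hkt : k ≤ t.unop.unop := leOfHom f.unop.unop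
  refine ⟨t.unop.unop, hkt, he c _ (Ideal.pow_le_pow_right hkt) ?_⟩
  exact hfg.trans (map_zero (D.map g).hom)

end LocalCohomologyOne

/-! ### Depth, finite length and filter regular pairs -/

section CommAlg

open IsLocalRing RingTheory.Sequence
open scoped Pointwise

variable {A : Type u} [CommRing A]

theorem mem_smul_top_iff {X : Type v} [AddCommGroup X] [Module A X] (a : A) (x : X) :
    x ∈ (a • ⊤ : Submodule A X) ↔ ∃ y, x = a • y := by
  simp [Submodule.mem_smul_pointwise_iff_exists, eq_comm]

theorem mem_ofList_singleton_smul_top_iff {X : Type v} [AddCommGroup X] [Module A X] (a : A)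
    (x : X) : x ∈ (Ideal.ofList [a] • ⊤ : Submodule A X) ↔ ∃ y, x = a • y := by
  rw [Ideal.ofList_singleton, Submodule.ideal_span_singleton_smul, mem_smul_top_iff]

variable [IsLocalRing A]

theorem length_le_moduleDepth_of_isRegular {X : Type v} [AddCommGroup X] [Module A X] {rs : List A}
    (hm : ∀ r ∈ rs, r ∈ maximalIdeal A) (h : IsRegular X rs) :
    (rs.length : ℕ∞) ≤ moduleDepth A X :=
  le_iSup₂_of_le rs ⟨hm, h⟩ le_rfl

theorem exists_isSMulRegular_of_moduleDepth_pos {X : Type v} [AddCommGroup X] [Module A X]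
    (h : 0 < moduleDepth A X) : ∃ r ∈ maximalIdeal A, IsSMulRegular X r := by
  simp only [moduleDepth, lt_iSup_iff] at h
  obtain ⟨rs, ⟨hm, hrs⟩, h⟩ := h
  match rs with
  | [] => simp at h
  | r :: rs =>
    exact ⟨r, hm r (by simp), ((isRegular_cons_iff X r rs).1 hrs).1⟩

theorem exists_isSMulRegular_of_two_le_moduleDepth {X : Type v} [AddCommGroup X] [Module A X]
    (h : 2 ≤ moduleDepth A X) :
    ∃ r ∈ maximalIdeal A, ∃ s ∈ maximalIdeal A, IsSMulRegular X r ∧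
      ∀ x y : X, s • x = r • y → ∃ z, x = r • z := by
  -- A strict bound on the supremum yields a witnessing sequence without knowing that the supremum
  -- is attained.
  replace h : 1 < moduleDepth A X := lt_of_lt_of_le (by norm_num) h
  simp only [moduleDepth, lt_iSup_iff] at h
  obtain ⟨rs, ⟨hm, hrs⟩, h⟩ := h
  match rs with
  | [] => simp at h
  | [r] => simp at h
  | r :: s :: rs =>
    have h1 := (isRegular_cons_iff X r _).1 hrs
    have h2 := ((isRegular_cons_iff _ s _).1 h1.2).1
    refine ⟨r, hm r (by simp), s, hm s (by simp), h1.1, fun x y hxy ↦ ?_⟩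
    rw [← mem_smul_top_iff]
    exact mem_of_isSMulRegular_quotient_of_smul_mem h2 ((mem_smul_top_iff r _).2 ⟨y, hxy⟩)

theorem isRegular_pair {X : Type v} [AddCommGroup X] [Module A X] [Nontrivial X]
    [Module.Finite A X] {a b : A} (ham : a ∈ maximalIdeal A) (hbm : b ∈ maximalIdeal A)
    (ha : IsSMulRegular X a) (hb : ∀ x y : X, b • x = a • y → ∃ z, x = a • z) :
    IsRegular X [a, b] := by
  have hm : ∀ r ∈ [a, b], r ∈ maximalIdeal A := by
    simpa using ⟨ham, hbm⟩
  refine IsRegular.of_isWeaklyRegular_of_mem_maximalIdeal X hm ?_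
  rw [isWeaklyRegular_cons_iff, isWeaklyRegular_cons_iff]
  refine ⟨ha, (isSMulRegular_quotient_iff_mem_of_smul_mem _ _).2 fun x hx ↦ ?_, .nil _ _⟩
  obtain ⟨y, hy⟩ := (mem_smul_top_iff a _).1 hx
  exact (mem_smul_top_iff a _).2 (hb x y hy)

/-- A finite module over a Noetherian local ring which is killed by a power of the maximal ideal
has finite length. -/
theorem length_lt_top_of_pow_smul_eq_zero [IsNoetherianRing A] {X : Type v} [AddCommGroup X]
    [Module A X] [Module.Finite A X] (n : ℕ)
    (h : ∀ r ∈ maximalIdeal A ^ n, ∀ x : X, r • x = 0) : Module.length A X < ⊤ := by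
  -- The exponent n + 1 keeps the ideal proper even when n = 0.
  let I := maximalIdeal A ^ (n + 1)
  have hI : I ≤ maximalIdeal A := Ideal.pow_le_self (Nat.succ_ne_zero n)
  have : Nontrivial (A ⧸ I) :=
    Ideal.Quotient.nontrivial_iff.2 fun h ↦
      (maximalIdeal.isMaximal A).ne_top (top_le_iff.1 (h ▸ hI))
  have := IsLocalRing.of_surjective' (Ideal.Quotient.mk I) Ideal.Quotient.mk_surjective
  have hmap : maximalIdeal (A ⧸ I) ≤ (maximalIdeal A).map (Ideal.Quotient.mk I) := by
    intro x hx
    obtain ⟨a, rfl⟩ := Ideal.Quotient.mk_surjective x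
    refine Ideal.mem_map_of_mem _ ?_
    by_contra ha
    exact hx (((notMem_maximalIdeal).1 ha).map _)
  have : IsArtinianRing (A ⧸ I) := by
    rw [isArtinianRing_iff_isNilpotent_maximalIdeal]
    refine ⟨n + 1, le_bot_iff.1 ((Ideal.pow_right_mono hmap _).trans ?_)⟩
    rw [← Ideal.map_pow, Ideal.map_quotient_self]
  have htor : Module.IsTorsionBySet A X I := fun x r ↦
    h r (Ideal.pow_le_pow_right (Nat.le_succ n) r.2) x
  let _ : Module (A ⧸ I) X := htor.module
  have : Module.Finite (A ⧸ I) X := Module.Finite.of_restrictScalars_finite A _ _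
  have : IsArtinian A X :=
    (LinearMap.isArtinian_iff_of_bijective htor.semilinearMap Function.bijective_id).2 inferInstance
  exact Module.length_ne_top.lt_top

theorem exists_pow_smul_eq_zero_of_length_lt_top {X : Type v} [AddCommGroup X] [Module A X]
    (h : Module.length A X < ⊤) : ∃ n, ∀ r ∈ maximalIdeal A ^ n, ∀ x : X, r • x = 0 := by
  obtain ⟨_, _⟩ := isFiniteLength_iff_isNoetherian_isArtinian.1
    (Module.length_ne_top_iff.1 h.ne)
  -- The chain 𝔪ⁿX stabilizes, and Nakayama makes its stable value zero.
  obtain ⟨n, hn⟩ := IsArtinian.monotone_stabilizes (R := A) (M := X)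
    ⟨fun n ↦ OrderDual.toDual ((maximalIdeal A ^ n) • ⊤), fun a b hab ↦
      Submodule.smul_mono_left (Ideal.pow_le_pow_right hab)⟩
  have h1 : (maximalIdeal A ^ n) • (⊤ : Submodule A X) = (maximalIdeal A ^ (n + 1)) • ⊤ :=
    hn (n + 1) (Nat.le_succ n)
  have h2 : (maximalIdeal A ^ n) • (⊤ : Submodule A X) = ⊥ := by
    refine Submodule.eq_bot_of_le_smul_of_le_jacobson_bot (maximalIdeal A) _
      (IsNoetherian.noetherian _) ?_ (maximalIdeal_le_jacobson _)
    rw [← Submodule.mul_smul, ← pow_succ', ← h1]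
  exact ⟨n, fun r hr x ↦ (Submodule.mem_bot A).1
    (h2 ▸ Submodule.smul_mem_smul hr Submodule.mem_top)⟩

variable {M : Type u} [AddCommGroup M] [Module A M]

/-- If the first local cohomology module is finite, then its annihilator contains a power of the
maximal ideal. -/
theorem exists_pow_le_annLocalCohomologyOne
    (hfin : Module.Finite A ((localCohomology (maximalIdeal A) 1).obj (ModuleCat.of A M))) :
    ∃ n, maximalIdeal A ^ n ≤ annLocalCohomologyOne A M := by
  obtain ⟨s, hs⟩ := hfin.fg_top
  choose n hn using exists_pow_smul_localCohomology_eq_zero (maximalIdeal A) (ModuleCat.of A M)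
  refine ⟨s.sup n, fun r hr ↦ Module.mem_annihilator.2 fun e ↦ ?_⟩
  have he : e ∈ Submodule.span A (s : Set _) := hs ▸ Submodule.mem_top
  induction he using Submodule.span_induction with
  | mem x hx => exact hn x r (Ideal.pow_le_pow_right (Finset.le_sup hx) hr)
  | zero => exact smul_zero r
  | add x y _ _ hx hy => rw [smul_add, hx, hy, add_zero]
  | smul c x _ hx => rw [smul_comm, hx, smul_zero]

/-- The annihilator of the first local cohomology module of `M` multiplies into `M` all elements
of an overmodule of positive depth which are multiplied into `M` by a power of the maximal
ideal. -/
theorem smul_mem_range_of_mem_annLocalCohomologyOne {X : Type v} [AddCommGroup X] [Module A X]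
    {f : M →ₗ[A] X} (hf : Function.Injective f) {c : A} (hc : c ∈ annLocalCohomologyOne A M)
    {r : A} (hr : r ∈ maximalIdeal A) (hreg : IsSMulRegular X r) {k : ℕ} {x : X}
    (hx : ∀ j ∈ maximalIdeal A ^ k, j • x ∈ LinearMap.range f) : c • x ∈ LinearMap.range f := by
  let φ : ↥(maximalIdeal A ^ k) →ₗ[A] M := (LinearEquiv.ofInjective f hf).symm.toLinearMap ∘ₗ
    LinearMap.codRestrict (LinearMap.range f)
      (LinearMap.toSpanSingleton A X x ∘ₗ (maximalIdeal A ^ k).subtype) fun j ↦ hx j j.2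
  have hφ : ∀ j, f (φ j) = (j : A) • x := fun j ↦
    congrArg Subtype.val ((LinearEquiv.ofInjective f hf).apply_symm_apply _)
  obtain ⟨t, hkt, w, hw⟩ := exists_smul_eq_smul_of_smul_localCohomology_eq_zero (maximalIdeal A)
    (ModuleCat.of A M) c (Module.mem_annihilator.1 hc) k φ
  refine ⟨w, ?_⟩
  have h1 := congr(f $(hw (r ^ t) (Ideal.pow_mem_pow hr t)))
  rw [map_smul, map_smul, hφ, smul_comm] at h1
  exact ((hreg.pow t) h1).symm

theorem isFilterRegular_pair_iff {a b : A} : IsFilterRegular M [a, b] ↔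
    (a ∈ maximalIdeal A ∧ b ∈ maximalIdeal A) ∧
    (∀ p ∈ associatedPrimes A M, p ≠ maximalIdeal A → a ∉ p) ∧
    ∀ p ∈ associatedPrimes A (M ⧸ (Ideal.ofList [a] • ⊤ : Submodule A M)),
      p ≠ maximalIdeal A → b ∉ p := by
  have e : (M ⧸ (Ideal.ofList (List.take 0 [a, b]) • ⊤ : Submodule A M)) ≃ₗ[A] M :=
    Submodule.quotEquivOfEqBot _ (by simp)
  have h0 := LinearEquiv.AssociatedPrimes.eq e
  constructor
  · rintro ⟨hm, h⟩
    exact ⟨by simpa using hm, fun p hp ↦ h 0 (by simp) p (h0 ▸ hp), h 1 (by simp)⟩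
  · rintro ⟨hm, h1, h2⟩
    refine ⟨by simpa using hm, fun i hi ↦ ?_⟩
    match i, hi with
    | 0, _ => exact fun p hp ↦ h1 p (h0 ▸ hp)
    | 1, _ => exact h2

variable [IsNoetherianRing A]

/-- Minimal primes over the annihilator are associated, so its radical contains 𝔪. -/
theorem exists_pow_smul_eq_zero_of_associatedPrimes {K : Type v} [AddCommGroup K] [Module A K]
    [Module.Finite A K] (h : ∀ p ∈ associatedPrimes A K, p = maximalIdeal A) :
    ∃ n, ∀ r ∈ maximalIdeal A ^ n, ∀ x : K, r • x = 0 := by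
  have hle : maximalIdeal A ≤ (Module.annihilator A K).radical := by
    rw [← Ideal.sInf_minimalPrimes]
    exact le_sInf fun p hp ↦
      (h p (Module.associatedPrimes.minimalPrimes_annihilator_subset_associatedPrimes A K hp)).ge
  obtain ⟨n, hn⟩ := Ideal.exists_pow_le_of_le_radical_of_fg hle (IsNoetherian.noetherian _)
  exact ⟨n, fun r hr ↦ Module.mem_annihilator.1 (hn hr)⟩

theorem exists_mem_notMem_associatedPrimes (I : Ideal A) (n : ℕ) (hI : maximalIdeal A ^ n ≤ I)
    (N : Type v) [AddCommGroup N] [Module A N] [Module.Finite A N] :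
    ∃ a ∈ I, ∀ p ∈ associatedPrimes A N, p ≠ maximalIdeal A → a ∉ p := by
  by_contra! hcon
  -- Prime avoidance exempts two indices from primality; both are filled with the dummy `⊤`, as the
  -- whole family is prime.
  obtain ⟨p, ⟨hp, hpm⟩, hle⟩ := (Ideal.subset_union_prime_finite
    (s := {p | p ∈ associatedPrimes A N ∧ p ≠ maximalIdeal A})
    ((associatedPrimes.finite A N).subset fun p hp ↦ hp.1) (f := id) ⊤ ⊤
    (fun p hp _ _ ↦ hp.1.isPrime) (I := I)).1 fun a ha ↦ by
      obtain ⟨p, hp, hpm, hap⟩ := hcon a ha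
      exact Set.mem_biUnion (show p ∈ {p | _} from ⟨hp, hpm⟩) hap
  have := hp.isPrime
  exact hpm ((maximalIdeal.isMaximal A).eq_of_le this.ne_top
    (this.le_of_pow_le (hI.trans hle))).symm

theorem isSMulRegular_of_forall_notMem {a r : A} (hr : r ∈ maximalIdeal A)
    (hreg : IsSMulRegular M r)
    (h : ∀ p ∈ associatedPrimes A M, p ≠ maximalIdeal A → a ∉ p) : IsSMulRegular M a := by
  have hU := biUnion_associatedPrimes_eq_compl_regular A M
  by_contra ha
  have hmem : a ∈ ⋃ p ∈ associatedPrimes A M, (p : Set A) := hU ▸ ha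
  simp only [Set.mem_iUnion] at hmem
  obtain ⟨p, hp, hap⟩ := hmem
  refine h p hp ?_ hap
  rintro rfl
  have : r ∈ {r : A | IsSMulRegular M r}ᶜ := hU ▸ Set.mem_biUnion hp hr
  exact this hreg

/-- The kernel of b on M/aM is killed by b, so its associated primes contain b; filter regularity
leaves only 𝔪. -/
theorem exists_pow_smul_mem_of_filterRegular [Module.Finite A M] {a b : A}
    (h : ∀ p ∈ associatedPrimes A (M ⧸ (Ideal.ofList [a] • ⊤ : Submodule A M)),
      p ≠ maximalIdeal A → b ∉ p) :
    ∃ k, ∀ m n : M, b • m = a • n → ∀ r ∈ maximalIdeal A ^ k, ∃ n', r • m = a • n' := by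
  let N := M ⧸ (Ideal.ofList [a] • ⊤ : Submodule A M)
  let K : Submodule A N := LinearMap.ker (LinearMap.lsmul A N b)
  obtain ⟨k, hk⟩ := exists_pow_smul_eq_zero_of_associatedPrimes (K := K) fun p hp ↦ by
    by_contra hpm
    refine h p (associatedPrimes.subset_of_injective K.subtype_injective hp) hpm ?_
    refine hp.annihilator_le ?_
    rw [Module.mem_annihilator]
    exact fun x ↦ Subtype.ext (Subtype.ext (LinearMap.mem_ker.1 x.1.2))
  refine ⟨k, fun m n hmn r hr ↦ ?_⟩
  rw [← mem_ofList_singleton_smul_top_iff, ← Submodule.Quotient.mk_eq_zero]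
  have hm : (Submodule.Quotient.mk m : N) ∈ K := by
    rw [LinearMap.mem_ker, LinearMap.lsmul_apply, ← Submodule.Quotient.mk_smul,
      Submodule.Quotient.mk_eq_zero, mem_ofList_singleton_smul_top_iff]
    exact ⟨n, hmn⟩
  exact congr(K.subtype $(hk r hr ⟨_, hm⟩))

theorem exists_isFilterRegular_pair [Module.Finite A M]
    (hfin : Module.Finite A ((localCohomology (maximalIdeal A) 1).obj (ModuleCat.of A M))) :
    ∃ a₁ ∈ annLocalCohomologyOne A M, ∃ a₂ ∈ annLocalCohomologyOne A M,
      IsFilterRegular M [a₁, a₂] := by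
  obtain ⟨n, hn⟩ := exists_pow_le_annLocalCohomologyOne hfin
  -- If H¹ = 0 its annihilator is all of A, hence the intersection with 𝔪 and the positive exponent.
  have hI : maximalIdeal A ^ (n + 1) ≤ annLocalCohomologyOne A M ⊓ maximalIdeal A :=
    le_inf ((Ideal.pow_le_pow_right (Nat.le_succ n)).trans hn)
      (Ideal.pow_le_self (Nat.succ_ne_zero n))
  obtain ⟨a, ha, hap⟩ := exists_mem_notMem_associatedPrimes _ _ hI M
  obtain ⟨b, hb, hbp⟩ := exists_mem_notMem_associatedPrimes _ _ hI
    (M ⧸ (Ideal.ofList [a] • ⊤ : Submodule A M))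
  exact ⟨a, ha.1, b, hb.1, isFilterRegular_pair_iff.2 ⟨⟨ha.2, hb.2⟩, hap, hbp⟩⟩

end CommAlg

/-! ### The module M~ and its universal property -/

section TildeModule

variable {A : Type u} [CommRing A] {M : Type v} [AddCommGroup M] [Module A M]

theorem isSMulRegular_localizedModule (a : A⁰[M]) :
    IsSMulRegular (LocalizedModule (A⁰[M]) M) (a : A) :=
  Function.LeftInverse.injective (LocalizedModule.divBy_mul_by a)

theorem mkLinearMap_nonZeroSMulDivisors_injective :
    Function.Injective (LocalizedModule.mkLinearMap (A⁰[M]) M) := by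
  intro m n h
  obtain ⟨c, hc⟩ := (IsLocalizedModule.eq_iff_exists (A⁰[M]) _).1 h
  exact (isSMulRegular_iff_mem_nonZeroSMulDivisors (M := M).2 c.2) hc

variable {a : A⁰[M]} {b : A}

theorem smul_mk_self (m : M) :
    (a : A) • LocalizedModule.mk m a = LocalizedModule.mkLinearMap (A⁰[M]) M m := by
  rw [LocalizedModule.smul'_mk]
  exact LocalizedModule.mk_cancel a m

theorem mem_tildeModule_iff {z : LocalizedModule (A⁰[M]) M} :
    z ∈ tildeModule M a b ↔
      (a : A) • z ∈ LinearMap.range (LocalizedModule.mkLinearMap (A⁰[M]) M) ∧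
      b • z ∈ LinearMap.range (LocalizedModule.mkLinearMap (A⁰[M]) M) := by
  constructor
  · rintro ⟨m, ⟨n, hn⟩, rfl⟩
    refine ⟨⟨m, (smul_mk_self m).symm⟩, n, isSMulRegular_localizedModule a ?_⟩
    dsimp only
    rw [smul_comm (a : A) b, smul_mk_self, ← LinearMap.map_smul, ← LinearMap.map_smul, hn]
  · rintro ⟨⟨m, hm⟩, n, hn⟩
    refine ⟨m, ⟨n, mkLinearMap_nonZeroSMulDivisors_injective (A := A) ?_⟩,
      isSMulRegular_localizedModule a (hm.symm.trans (smul_mk_self m).symm)⟩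
    rw [map_smul, map_smul, hm, hn, smul_comm]

theorem toTildeModule_injective : Function.Injective (toTildeModule M a b) := fun _ _ h ↦
  mkLinearMap_nonZeroSMulDivisors_injective congr(Subtype.val $h)

theorem mem_range_toTildeModule_iff {z : tildeModule M a b} :
    z ∈ LinearMap.range (toTildeModule M a b) ↔
      (z : LocalizedModule (A⁰[M]) M) ∈
        LinearMap.range (LocalizedModule.mkLinearMap (A⁰[M]) M) :=
  exists_congr fun _ ↦ Subtype.ext_iff

theorem span_pair_le_annihilator_quotient_iff {X : Type*} [AddCommGroup X] [Module A X]
    (N : Submodule A X) (a b : A) :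
    Ideal.span {a, b} ≤ Module.annihilator A (X ⧸ N) ↔ ∀ x, a • x ∈ N ∧ b • x ∈ N := by
  have h : ∀ c : A, c ∈ Module.annihilator A (X ⧸ N) ↔ ∀ x, c • x ∈ N := fun c ↦ by
    rw [Module.mem_annihilator, N.mkQ_surjective.forall]
    refine forall_congr' fun x ↦ ?_
    rw [← map_smul, Submodule.mkQ_apply, Submodule.Quotient.mk_eq_zero]
  rw [Ideal.span_le, Set.insert_subset_iff, Set.singleton_subset_iff, SetLike.mem_coe,
    SetLike.mem_coe, h, h, forall_and]

theorem isSMulRegular_tildeModule (a' : A⁰[M]) : IsSMulRegular (tildeModule M a b) (a' : A) :=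
  (isSMulRegular_localizedModule a').submodule _ _

/-- Multiplication by a embeds M~ into the image of M. -/
theorem tildeModule_finite [IsNoetherianRing A] [Module.Finite A M] :
    Module.Finite A (tildeModule M a b) := by
  have hr : ∀ z : tildeModule M a b,
      (a : A) • z ∈ LinearMap.range (toTildeModule M a b) := fun z ↦
    mem_range_toTildeModule_iff.2 (mem_tildeModule_iff.1 z.2).1
  refine Module.Finite.of_injective
    (LinearMap.codRestrict _ (LinearMap.lsmul A (tildeModule M a b) (a : A)) hr) ?_
  exact fun x y h ↦ isSMulRegular_tildeModule a congr(Subtype.val $h)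

section UniversalProperty

variable {X : Type*} [AddCommGroup X] [Module A X] {f : M →ₗ[A] X}

theorem smul_apply_eq_of_comp_eq {g : X →ₗ[A] tildeModule M a b}
    (hg : g ∘ₗ f = toTildeModule M a b) {x : X} {c : A} {m : M} (hm : f m = c • x) :
    c • g x = toTildeModule M a b m := by
  rw [← map_smul, ← hm, ← hg, LinearMap.comp_apply]

theorem existsUnique_comp_eq_toTildeModule (hf : Function.Injective f)
    (h : ∀ x, (a : A) • x ∈ LinearMap.range f ∧ b • x ∈ LinearMap.range f) :
    ∃! g : X →ₗ[A] tildeModule M a b, g ∘ₗ f = toTildeModule M a b := by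
  let φ : X →ₗ[A] M := (LinearEquiv.ofInjective f hf).symm.toLinearMap ∘ₗ
    LinearMap.codRestrict (LinearMap.range f) (LinearMap.lsmul A X (a : A)) fun x ↦ (h x).1
  have hφ : ∀ x, f (φ x) = (a : A) • x := fun x ↦
    congrArg Subtype.val ((LinearEquiv.ofInjective f hf).apply_symm_apply _)
  let g₀ : X →ₗ[A] LocalizedModule (A⁰[M]) M :=
    LocalizedModule.divBy a ∘ₗ LocalizedModule.mkLinearMap (A⁰[M]) M ∘ₗ φ
  have hg₀ : ∀ x, (a : A) • g₀ x = LocalizedModule.mkLinearMap (A⁰[M]) M (φ x) := fun x ↦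
    LocalizedModule.mul_by_divBy a _
  have hg₀f : ∀ m, g₀ (f m) = LocalizedModule.mkLinearMap (A⁰[M]) M m := fun m ↦ by
    refine isSMulRegular_localizedModule a ?_
    dsimp only
    rw [hg₀, ← map_smul]
    congr 1
    exact hf (by rw [hφ, map_smul])
  refine ⟨g₀.codRestrict _ fun x ↦ mem_tildeModule_iff.2 ⟨⟨φ x, (hg₀ x).symm⟩, ?_⟩,
    LinearMap.ext fun m ↦ Subtype.ext (hg₀f m), fun g hg ↦ LinearMap.ext fun x ↦ ?_⟩
  · obtain ⟨n, hn⟩ := (h x).2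
    exact ⟨n, by rw [← map_smul, ← hn, hg₀f]⟩
  · refine isSMulRegular_tildeModule a ?_
    dsimp only
    rw [smul_apply_eq_of_comp_eq hg (hφ x)]
    exact Subtype.ext (hg₀ x).symm

/-- If g x = 0, then ax lies in M and has zero image under the injection M → M~, so ax = 0. -/
theorem injective_iff_isSMulRegular_of_comp_eq
    (h : ∀ x, (a : A) • x ∈ LinearMap.range f ∧ b • x ∈ LinearMap.range f)
    {g : X →ₗ[A] tildeModule M a b} (hg : g ∘ₗ f = toTildeModule M a b) :
    Function.Injective g ↔ IsSMulRegular X (a : A) := by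
  constructor
  · exact fun hginj ↦ (isSMulRegular_tildeModule a).of_injective g hginj
  · intro hreg
    rw [injective_iff_map_eq_zero]
    intro x hx
    obtain ⟨m, hm⟩ := (h x).1
    have h1 := smul_apply_eq_of_comp_eq hg hm
    rw [hx, smul_zero] at h1
    rw [toTildeModule_injective (h1.symm.trans (map_zero _).symm), map_zero] at hm
    exact hreg.right_eq_zero_of_smul hm.symm

end UniversalProperty

end TildeModule

/-! ### The equivalences and the main theorem -/

section Main

open IsLocalRing RingTheory.Sequence

variable {A : Type u} [CommRing A] [IsLocalRing A] {M : Type u} [AddCommGroup M] [Module A M]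
  {X : Type v} [AddCommGroup X] [Module A X] {f : M →ₗ[A] X}

/-- A nonzerodivisor on `M` is regular on an overmodule of positive depth and finite colength. -/
theorem isSMulRegular_of_length_lt_top (hf : Function.Injective f) {a : A}
    (ha : IsSMulRegular M a) (hdepth : 0 < moduleDepth A X)
    (hlen : Module.length A (X ⧸ LinearMap.range f) < ⊤) : IsSMulRegular X a := by
  obtain ⟨r, hr, hreg⟩ := exists_isSMulRegular_of_moduleDepth_pos hdepth
  obtain ⟨k, hk⟩ := exists_pow_smul_eq_zero_of_length_lt_top hlen
  refine isSMulRegular_iff_right_eq_zero_of_smul.2 fun x hx ↦ ?_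
  obtain ⟨m, hm⟩ := (Submodule.Quotient.mk_eq_zero _).1
    (hk (r ^ k) (Ideal.pow_mem_pow hr k) (Submodule.Quotient.mk x))
  have h1 : f (a • m) = f 0 := by rw [map_smul, hm, smul_comm, hx, smul_zero, map_zero]
  have h2 : m = 0 := ha.right_eq_zero_of_smul (hf h1)
  rw [h2, map_zero] at hm
  exact (hreg.pow k).right_eq_zero_of_smul hm.symm

/-- This puts the overmodules of (B) under the hypothesis of (A): a finite length cokernel is killed
by a power of 𝔪, so the pivot applies. -/
theorem smul_mem_range_of_length_lt_top (hf : Function.Injective f) {c : A}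
    (hc : c ∈ annLocalCohomologyOne A M) (hdepth : 0 < moduleDepth A X)
    (hlen : Module.length A (X ⧸ LinearMap.range f) < ⊤) (x : X) :
    c • x ∈ LinearMap.range f := by
  obtain ⟨r, hr, hreg⟩ := exists_isSMulRegular_of_moduleDepth_pos hdepth
  obtain ⟨k, hk⟩ := exists_pow_smul_eq_zero_of_length_lt_top hlen
  exact smul_mem_range_of_mem_annLocalCohomologyOne hf hc hr hreg fun j hj ↦
    (Submodule.Quotient.mk_eq_zero _).1 (hk j hj (Submodule.Quotient.mk x))

variable {a : A⁰[M]} {b : A}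

theorem exists_pow_smul_mem_range_toTildeModule [IsNoetherianRing A] [Module.Finite A M]
    (h : IsFilterRegular M [(a : A), b]) : ∃ k, ∀ r ∈ maximalIdeal A ^ k,
      ∀ z : tildeModule M a b, r • z ∈ LinearMap.range (toTildeModule M a b) := by
  obtain ⟨k, hk⟩ := exists_pow_smul_mem_of_filterRegular (isFilterRegular_pair_iff.1 h).2.2
  refine ⟨k, fun r hr z ↦ ?_⟩
  obtain ⟨m, ⟨n, hn⟩, hz⟩ := z.2
  obtain ⟨n', hn'⟩ := hk m n hn r hr
  refine mem_range_toTildeModule_iff.2 ⟨n', isSMulRegular_localizedModule a ?_⟩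
  dsimp only
  rw [Submodule.coe_smul, hz, smul_comm, smul_mk_self, ← map_smul, ← map_smul, hn']

/-- The pair `a, b` is a regular sequence on `tildeModule M a b`. -/
theorem exists_eq_smul_of_smul_eq_smul_tildeModule [IsNoetherianRing A] [Module.Finite A M]
    (ha : (a : A) ∈ annLocalCohomologyOne A M) (hb : b ∈ annLocalCohomologyOne A M)
    (h : IsFilterRegular M [(a : A), b]) (x y : tildeModule M a b)
    (hxy : b • x = (a : A) • y) : ∃ z, x = (a : A) • z := by
  obtain ⟨k, hk⟩ := exists_pow_smul_mem_range_toTildeModule h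
  let z : LocalizedModule (A⁰[M]) M := LocalizedModule.divBy a x
  have haz : (a : A) • z = x := LocalizedModule.mul_by_divBy a _
  have hbz : b • z = y := by
    refine isSMulRegular_localizedModule a ?_
    dsimp only
    rw [smul_comm, haz]
    exact congr(Subtype.val $hxy)
  -- One factor 𝔪^k moves z into M~, because it moves az = x and bz = y into M; the other moves M~
  -- into M.
  have hz : ∀ j ∈ maximalIdeal A ^ (k + k),
      j • z ∈ LinearMap.range (LocalizedModule.mkLinearMap (A⁰[M]) M) := by
    have h1 : ∀ j ∈ maximalIdeal A ^ k, j • z ∈ tildeModule M a b := fun j hj ↦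
      mem_tildeModule_iff.2
        ⟨by rw [smul_comm, haz]; exact mem_range_toTildeModule_iff.1 (hk j hj x),
          by rw [smul_comm, hbz]; exact mem_range_toTildeModule_iff.1 (hk j hj y)⟩
    have h2 : maximalIdeal A ^ k * maximalIdeal A ^ k ≤
        (LinearMap.range (LocalizedModule.mkLinearMap (A⁰[M]) M)).comap
          (LinearMap.toSpanSingleton A _ z) :=
      Ideal.mul_le.2 fun i hi j hj ↦ by
        rw [Submodule.mem_comap, LinearMap.toSpanSingleton_apply, mul_smul]
        exact mem_range_toTildeModule_iff.1 (hk i hi ⟨_, h1 j hj⟩)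
    intro j hj
    rw [pow_add] at hj
    exact h2 hj
  have ham := (isFilterRegular_pair_iff.1 h).1.1
  have hreg := isSMulRegular_localizedModule a
  exact ⟨⟨z, mem_tildeModule_iff.2
    ⟨smul_mem_range_of_mem_annLocalCohomologyOne mkLinearMap_nonZeroSMulDivisors_injective
        ha ham hreg hz,
      smul_mem_range_of_mem_annLocalCohomologyOne mkLinearMap_nonZeroSMulDivisors_injective
        hb ham hreg hz⟩⟩, Subtype.ext haz.symm⟩

/-- An overmodule of depth at least two which lies in `tildeModule M a b` exhausts it. -/
theorem surjective_of_two_le_moduleDepth [IsNoetherianRing A] [Module.Finite A M]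
    (h : IsFilterRegular M [(a : A), b]) (hf : Function.Injective f)
    (hdepth : 2 ≤ moduleDepth A X) {g : X →ₗ[A] tildeModule M a b}
    (hginj : Function.Injective g) (hg : g ∘ₗ f = toTildeModule M a b) :
    Function.Surjective g := by
  obtain ⟨r, hr, s, hs, hreg, hrs⟩ := exists_isSMulRegular_of_two_le_moduleDepth hdepth
  obtain ⟨k, hk⟩ := exists_pow_smul_mem_range_toTildeModule h
  have hrM : r ∈ A⁰[M] :=
    isSMulRegular_iff_mem_nonZeroSMulDivisors.1 (hreg.of_injective f hf)
  have hle : ∀ z, z ∈ LinearMap.range (toTildeModule M a b) → z ∈ LinearMap.range g := by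
    rintro _ ⟨m, rfl⟩
    exact ⟨f m, congr($hg m)⟩
  -- From s(rz) = r(sz), regularity of r, s on X divides rz by r inside X; r stays injective on M~,
  -- being a nonzerodivisor on M.
  have hdesc : ∀ z, r • z ∈ LinearMap.range g → s • z ∈ LinearMap.range g →
      z ∈ LinearMap.range g := by
    rintro z ⟨x, hx⟩ ⟨y, hy⟩
    obtain ⟨w, hw⟩ := hrs x y (hginj (by rw [map_smul, map_smul, hx, hy, smul_comm]))
    refine ⟨w, isSMulRegular_tildeModule ⟨r, hrM⟩ ?_⟩
    dsimp only
    rw [← hx, hw, map_smul]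
  have hind : ∀ n z, (∀ j ∈ maximalIdeal A ^ n, j • z ∈ LinearMap.range g) →
      z ∈ LinearMap.range g := by
    intro n
    induction n with
    | zero => exact fun z hz ↦ by simpa using hz 1 (by simp)
    | succ n ih =>
      intro z hz
      refine ih z fun j hj ↦ hdesc _ ?_ ?_
      · rw [← mul_smul]
        exact hz _ (pow_succ' (maximalIdeal A) n ▸ Ideal.mul_mem_mul hr hj)
      · rw [← mul_smul]
        exact hz _ (pow_succ' (maximalIdeal A) n ▸ Ideal.mul_mem_mul hs hj)
  exact fun z ↦ hind k z fun j hj ↦ hle _ (hk j hj z)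

theorem length_quotient_lt_top_of_injective [IsNoetherianRing A] [Module.Finite A M]
    (h : IsFilterRegular M [(a : A), b]) {g : X →ₗ[A] tildeModule M a b}
    (hginj : Function.Injective g) (hg : g ∘ₗ f = toTildeModule M a b) :
    Module.length A (X ⧸ LinearMap.range f) < ⊤ := by
  obtain ⟨k, hk⟩ := exists_pow_smul_mem_range_toTildeModule h
  have := tildeModule_finite (M := M) (a := a) (b := b)
  have : Module.Finite A X := Module.Finite.of_injective g hginj
  refine length_lt_top_of_pow_smul_eq_zero k fun r hr x ↦ ?_
  obtain ⟨x, rfl⟩ := Submodule.Quotient.mk_surjective _ x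
  rw [← Submodule.Quotient.mk_smul, Submodule.Quotient.mk_eq_zero]
  obtain ⟨m, hm⟩ := hk r hr (g x)
  exact ⟨m, hginj (by rw [map_smul, ← hm, ← hg, LinearMap.comp_apply])⟩

theorem tfae_injective [IsNoetherianRing A] [Module.Finite A M] [Nontrivial M]
    (h : IsFilterRegular M [(a : A), b]) (hf : Function.Injective f)
    (hfr : ∀ x, (a : A) • x ∈ LinearMap.range f ∧ b • x ∈ LinearMap.range f)
    {g : X →ₗ[A] tildeModule M a b} (hg : g ∘ₗ f = toTildeModule M a b) :
    List.TFAE [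
      Function.Injective g,
      IsSMulRegular X (a : A),
      0 < moduleDepth A X ∧ Module.length A (X ⧸ LinearMap.range f) < ⊤] := by
  have hinj := injective_iff_isSMulRegular_of_comp_eq hfr hg
  tfae_have 1 ↔ 2 := hinj
  tfae_have 2 → 3 := by
    intro hreg
    have hginj := hinj.2 hreg
    -- Injectivity of g makes X finite, so Nakayama upgrades weak regularity to regularity.
    have := tildeModule_finite (M := M) (a := a) (b := b)
    have : Module.Finite A X := Module.Finite.of_injective g hginj
    have : Nontrivial X := hf.nontrivial
    have ham := (isFilterRegular_pair_iff.1 h).1.1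
    have hm : ∀ r ∈ [(a : A)], r ∈ maximalIdeal A := by simpa using ham
    have hX : IsRegular X [(a : A)] := IsRegular.of_isWeaklyRegular_of_mem_maximalIdeal X hm
      ((isWeaklyRegular_cons_iff X _ _).2 ⟨hreg, .nil _ _⟩)
    refine ⟨lt_of_lt_of_le ?_ (length_le_moduleDepth_of_isRegular hm hX),
      length_quotient_lt_top_of_injective h hginj hg⟩
    simp
  tfae_have 3 → 2 := fun ⟨h1, h2⟩ ↦ isSMulRegular_of_length_lt_top hf
    (isSMulRegular_iff_mem_nonZeroSMulDivisors.2 a.2) h1 h2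
  tfae_finish

theorem tfae_bijective [IsNoetherianRing A] [Module.Finite A M] [Nontrivial M]
    (ha : (a : A) ∈ annLocalCohomologyOne A M) (hb : b ∈ annLocalCohomologyOne A M)
    (h : IsFilterRegular M [(a : A), b]) (hf : Function.Injective f)
    (hfr : ∀ x, (a : A) • x ∈ LinearMap.range f ∧ b • x ∈ LinearMap.range f)
    {g : X →ₗ[A] tildeModule M a b} (hg : g ∘ₗ f = toTildeModule M a b) :
    List.TFAE [
      Function.Bijective g,
      IsRegular X [(a : A), b],
      2 ≤ moduleDepth A X ∧ Module.length A (X ⧸ LinearMap.range f) < ⊤] := by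
  have htfae := tfae_injective h hf hfr hg
  have hm := (isFilterRegular_pair_iff.1 h).1
  tfae_have 1 → 2 := by
    intro hbij
    rw [(LinearEquiv.ofBijective g hbij).isRegular_congr]
    have := tildeModule_finite (M := M) (a := a) (b := b)
    have : Nontrivial (tildeModule M a b) :=
      (toTildeModule_injective (a := a) (b := b)).nontrivial
    exact isRegular_pair hm.1 hm.2 (isSMulRegular_tildeModule a)
      (exists_eq_smul_of_smul_eq_smul_tildeModule ha hb h)
  tfae_have 2 → 3 := by
    intro hreg
    have h1 : IsSMulRegular X (a : A) := ((isRegular_cons_iff X _ _).1 hreg).1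
    have h2 : IsSMulRegular X (a : A) ↔
        0 < moduleDepth A X ∧ Module.length A (X ⧸ LinearMap.range f) < ⊤ := htfae.out 1 2
    exact ⟨length_le_moduleDepth_of_isRegular (rs := [(a : A), b]) (by simpa using hm) hreg,
      (h2.1 h1).2⟩
  tfae_have 3 → 1 := by
    intro ⟨h1, h2⟩
    have h3 : Function.Injective g ↔
        0 < moduleDepth A X ∧ Module.length A (X ⧸ LinearMap.range f) < ⊤ := htfae.out 0 2
    have hginj := h3.2 ⟨lt_of_lt_of_le (by norm_num) h1, h2⟩
    exact ⟨hginj, surjective_of_two_le_moduleDepth h hf h1 hginj hg⟩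
  tfae_finish

end Main

theorem mainTheorem6 {A : Type u} [CommRing A] [IsLocalRing A] [IsNoetherianRing A]
    (M : Type u) [AddCommGroup M] [Module A M] [Module.Finite A M]
    (hdim : 2 ≤ Module.supportDim A M) (hdepth : 0 < moduleDepth A M)
    (hfin : Module.Finite A
      ((localCohomology (IsLocalRing.maximalIdeal A) 1).obj (ModuleCat.of A M))) :
    -- filter regular sequences of length two in the annihilator exist
    (∃ a₁ ∈ annLocalCohomologyOne A M, ∃ a₂ ∈ annLocalCohomologyOne A M,
      IsFilterRegular M [a₁, a₂]) ∧
    ∀ a₁ ∈ annLocalCohomologyOne A M, ∀ a₂ ∈ annLocalCohomologyOne A M,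
      IsFilterRegular M [a₁, a₂] →
      ∃ ha : a₁ ∈ A⁰[M],
        -- the natural map is an embedding with cokernel killed by `(a₁, a₂)`
        Function.Injective (toTildeModule M ⟨a₁, ha⟩ a₂) ∧
        Ideal.span {a₁, a₂} ≤ Module.annihilator A
          (tildeModule M ⟨a₁, ha⟩ a₂ ⧸ LinearMap.range (toTildeModule M ⟨a₁, ha⟩ a₂)) ∧
        -- universal property, and when the induced map is injective or bijective
        (∀ (X : Type v) [AddCommGroup X] [Module A X] (f : M →ₗ[A] X),
          Function.Injective f →
          Ideal.span {a₁, a₂} ≤ Module.annihilator A (X ⧸ LinearMap.range f) →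
          (∃! g : X →ₗ[A] tildeModule M ⟨a₁, ha⟩ a₂, g ∘ₗ f = toTildeModule M ⟨a₁, ha⟩ a₂) ∧
          ∀ g : X →ₗ[A] tildeModule M ⟨a₁, ha⟩ a₂,
            g ∘ₗ f = toTildeModule M ⟨a₁, ha⟩ a₂ →
            List.TFAE [
              Function.Injective g,
              IsSMulRegular X a₁,
              0 < moduleDepth A X ∧ Module.length A (X ⧸ LinearMap.range f) < ⊤] ∧
            List.TFAE [
              Function.Bijective g,
              RingTheory.Sequence.IsRegular X [a₁, a₂],
              2 ≤ moduleDepth A X ∧ Module.length A (X ⧸ LinearMap.range f) < ⊤]) ∧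
        -- overmodules of depth at least two and finite colength
        (∀ (X : Type v) [AddCommGroup X] [Module A X] (f : M →ₗ[A] X),
          Function.Injective f →
          2 ≤ moduleDepth A X →
          Module.length A (X ⧸ LinearMap.range f) < ⊤ →
          (∃! g : X →ₗ[A] tildeModule M ⟨a₁, ha⟩ a₂, g ∘ₗ f = toTildeModule M ⟨a₁, ha⟩ a₂) ∧
          ∀ g : X →ₗ[A] tildeModule M ⟨a₁, ha⟩ a₂,
            g ∘ₗ f = toTildeModule M ⟨a₁, ha⟩ a₂ → Function.Bijective g) := by
  -- The dimension bound enters through M ≠ 0: the zero module has dimension `⊥`.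
  have : Nontrivial M := by
    by_contra hM
    rw [not_nontrivial_iff_subsingleton] at hM
    rw [Module.supportDim_eq_bot_of_subsingleton] at hdim
    exact absurd hdim (by simp)
  refine ⟨exists_isFilterRegular_pair hfin, fun a₁ ha₁ a₂ ha₂ h ↦ ?_⟩
  obtain ⟨r, hr, hreg⟩ := exists_isSMulRegular_of_moduleDepth_pos hdepth
  have ha : a₁ ∈ A⁰[M] := isSMulRegular_iff_mem_nonZeroSMulDivisors.1
    (isSMulRegular_of_forall_notMem hr hreg (isFilterRegular_pair_iff.1 h).2.1)
  refine ⟨ha, toTildeModule_injective, ?_, ?_, ?_⟩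
  · rw [span_pair_le_annihilator_quotient_iff]
    exact fun z ↦ ⟨mem_range_toTildeModule_iff.2 (mem_tildeModule_iff.1 z.2).1,
      mem_range_toTildeModule_iff.2 (mem_tildeModule_iff.1 z.2).2⟩
  · intro X _ _ f hf hfr
    rw [span_pair_le_annihilator_quotient_iff] at hfr
    exact ⟨existsUnique_comp_eq_toTildeModule hf hfr, fun g hg ↦
      ⟨tfae_injective h hf hfr hg, tfae_bijective ha₁ ha₂ h hf hfr hg⟩⟩
  · intro X _ _ f hf hX hlen
    have hX' : 0 < moduleDepth A X := lt_of_lt_of_le (by norm_num) hX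
    have hfr : ∀ x, a₁ • x ∈ LinearMap.range f ∧ a₂ • x ∈ LinearMap.range f := fun x ↦
      ⟨smul_mem_range_of_length_lt_top hf ha₁ hX' hlen x,
        smul_mem_range_of_length_lt_top hf ha₂ hX' hlen x⟩
    refine ⟨existsUnique_comp_eq_toTildeModule hf hfr, fun g hg ↦ ?_⟩
    have hiff : Function.Bijective g ↔
        2 ≤ moduleDepth A X ∧ Module.length A (X ⧸ LinearMap.range f) < ⊤ :=
      (tfae_bijective ha₁ ha₂ h hf hfr hg).out 0 2
    exact hiff.2 ⟨hX, hlen⟩
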